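/- Let $Z=(Z(t))_{t\in T}$ be a zero-mean real Gaussian process on an arbitrary index set $T$ such that for every $s_0\in T$ there is a function $\varphi(\cdot\,;s_0):T\to\mathbb{R}$ for which the conditional distribution of $(Z(t))_{t\in T}$ given $Z(s_0)=0$ coincides with the distribution of $(\varphi(t;s_0)Z(t))_{t\in T}$. Here the conditional distribution given $Z(s_0)=0$ is the value at $0$ of a regular conditional distribution of $Z$ given $Z(s_0)$ whose finite-dimensional distributions are weakly continuous at $0$. Let $X=(X(s))_{s\in\mathbb{R}}$ be the stationary zero-mean Gaussian process with $\mathbb{E}[X(s)X(t)]=1/\cosh(t-s)$ for $s,t\in\mathbb{R}$. Call a pair $(x,y)$ of distinct positive real numbers admissible if the symmetric $4\times4$ matrix indexed by $\{A,B,C,D\}$ with unit diagonal, with $AB$- and $CD$-entries $1/\cosh x$, $AD$- and $BC$-entries $1/\cosh y$, and $AC$- and $BD$-entries $1/\cosh(x-y)$ is positive semi-definite; in this case let $Y_{x,y}=(Y(s))_{s\in\{A,B,C,D\}}$ be a zero-mean Gaussian process with this covariance matrix. Then there are a decomposition $T=\bigcup_{\alpha\in I}T_\alpha$ into pairwise disjoint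 sets and a function $a:T\to\mathbb{R}$ such that (i) the processes $(Z(t))_{t\in T_\alpha}$, $\alpha\in I$, are mutually independent; (ii) for each $\alpha\in I$, either there is a function $\psi_\alpha:T_\alpha\to\mathbb{R}$ such that $(Z(t))_{t\in T_\alpha}$ and $(a(t)X(\psi_\alpha(t)))_{t\in T_\alpha}$ have the same finite-dimensional distributions, or there are an admissible pair $(x,y)$ and a function $\psi_\alpha:T_\alpha\to\{A,B,C,D\}$ such that $(Z(t))_{t\in T_\alpha}$ and $(a(t)Y_{x,y}(\psi_\alpha(t)))_{t\in T_\alpha}$ have the same finite-dimensional distributions. -/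

import Mathlib

open MeasureTheory ProbabilityTheory

universe u v

/-- `ν` is the conditional distribution of the process `(Z t)_t` given `U = u`: there is a regular
conditional distribution `κ` of `Z` given `U` (a Markov kernel disintegrating the joint law of
`(U, Z)`) whose finite-dimensional distributions are weakly continuous at `u`, and `ν = κ u`.
Such a `ν` is unique whenever `u` lies in the support of the law of `U`. -/
def IsCondLawAt {T Ω : Type*} [MeasurableSpace Ω] (μ : Measure Ω) (Z : T → Ω → ℝ)
    (U : Ω → ℝ) (u : ℝ) (ν : Measure (T → ℝ)) : Prop :=
  ∃ κ : Kernel ℝ (T → ℝ), IsMarkovKernel κ ∧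
    μ.map (fun ω => (U ω, fun t => Z t ω)) = (μ.map U) ⊗ₘ κ ∧
    (∀ (F : Finset T) (g : BoundedContinuousFunction (F → ℝ) ℝ),
      ContinuousAt (fun v => ∫ x, g (F.restrict x) ∂(κ v)) u) ∧
    κ u = ν

/-- Equality of all finite-dimensional distributions of two real processes, possibly defined on
different probability spaces. -/
def FDDEq {S Ω Ω' : Type*} [MeasurableSpace Ω] [MeasurableSpace Ω']
    (V : S → Ω → ℝ) (μ : Measure Ω) (W : S → Ω' → ℝ) (P : Measure Ω') : Prop :=
  ∀ F : Finset S,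
    IdentDistrib (fun ω => F.restrict (fun s => V s ω)) (fun ω => F.restrict (fun s => W s ω)) μ P

/-- `V` is a zero-mean Gaussian process under `P` with covariance function `K`
(in particular `P` is a probability measure). -/
def IsCenteredGaussianWithCov {S Ω : Type*} [MeasurableSpace Ω]
    (V : S → Ω → ℝ) (P : Measure Ω) (K : S → S → ℝ) : Prop :=
  IsGaussianProcess V P ∧ (∀ s, ∫ ω, V s ω ∂P = 0) ∧ ∀ s t, ∫ ω, V s ω * V t ω ∂P = K s t

/-- The covariance function `1 / cosh (t - s)` on the real line. -/
noncomputable def sechCov (s t : ℝ) : ℝ := 1 / Real.cosh (t - s)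

/-- The index set `{A, B, C, D}`. -/
inductive FourPoint : Type
  | A | B | C | D

/-- The covariance function of the exceptional four-point process with parameters `x`, `y`. -/
noncomputable def quadCov (x y : ℝ) : FourPoint → FourPoint → ℝ
  | .A, .A | .B, .B | .C, .C | .D, .D => 1
  | .A, .B | .B, .A | .C, .D | .D, .C => 1 / Real.cosh x
  | .A, .D | .D, .A | .B, .C | .C, .B => 1 / Real.cosh y
  | .A, .C | .C, .A | .B, .D | .D, .B => 1 / Real.cosh (x - y)

/-- Admissible pairs `(x, y)`: distinct positive numbers for which the Gram matrix is positive
semi-definite. -/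
def AdmissiblePair (x y : ℝ) : Prop :=
  0 < x ∧ 0 < y ∧ x ≠ y ∧ (Matrix.of (quadCov x y)).PosSemidef

/-! Given `Z s₀ = 0`, a Gaussian process has the law of its residuals after regression on `Z s₀`.
Comparing second moments with those of `φ t * Z t` gives `K s t * (1 - φ s * φ t) = K s s₀ * K t s₀
/ K s₀ s₀` (`IsCondLawAt.covariance_eq`). Taking `s = t` forces `|φ t| < 1` wherever `K t s₀ ≠ 0`,
so `φ = tanh ψ` there, and `1 - tanh p * tanh q = cosh (q - p) / (cosh p * cosh q)` turns `K` into a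
rescaled `1 / cosh` (`exists_sechCov_of_regression_identity`).

Since `1 / cosh` never vanishes, being correlated is transitive; its classes are the blocks
(`exists_setoid_sechCov`), independent because uncorrelated and jointly Gaussian. One base point per
block suffices, so the four-point alternative is never needed. -/

open Filter Topology

/-! ### Gaussian series and the `1 / cosh` process -/

/-- Continuous linear functionals on a finite power of the real line, in coordinates. -/
lemma exists_strongDual_pi_eq_sum {ι : Type*} [Fintype ι] (L : StrongDual ℝ (ι → ℝ)) :
    ∃ l : ι → ℝ, ∀ x, L x = ∑ i, l i * x i := by
  classical
  refine ⟨fun i => L (Pi.single i 1), fun x => ?_⟩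
  conv_lhs => rw [← Finset.univ_sum_single x, map_sum]
  refine Finset.sum_congr rfl fun i _ => ?_
  rw [show (Pi.single i (x i) : ι → ℝ) = x i • Pi.single i 1 by
    rw [← Pi.single_smul]; simp, map_smul, smul_eq_mul, mul_comm]

lemma measurable_mul_coord (a : ℝ) (n : ℕ) : Measurable fun ω : ℕ → ℝ => a * ω n :=
  Measurable.const_mul (f := fun ω : ℕ → ℝ => ω n) (measurable_pi_apply n) a

/-- The characteristic function of a weighted sum of independent standard Gaussian variables. -/
lemma charFun_map_finsetSum_mul_infinitePi_gaussianReal (d : ℕ → ℝ) (N : ℕ) (u : ℝ) :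
    charFun ((Measure.infinitePi fun _ : ℕ => gaussianReal 0 1).map
      (fun ω => ∑ n ∈ Finset.range N, d n * ω n)) u =
      Complex.exp (-(∑ n ∈ Finset.range N, d n ^ 2 : ℝ) * u ^ 2 / 2) := by
  set P := Measure.infinitePi fun _ : ℕ => gaussianReal 0 1
  have hind : iIndepFun (fun n (ω : ℕ → ℝ) => d n * ω n) P := by
    have h : iIndepFun (fun n (ω : ℕ → ℝ) => ω n) P :=
      iIndepFun_infinitePi (X := fun _ x => x) (fun _ => measurable_id)
    exact h.comp (fun n x => d n * x) (fun n => by fun_prop)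
  rw [iIndepFun.charFun_map_fun_finsetSum_eq_prod
    (fun n _ => (measurable_mul_coord (d n) n).aemeasurable)
    (hind.precomp (g := ((↑) : Finset.range N → ℕ)) Subtype.val_injective)]
  have hmap (n : ℕ) : P.map (fun ω => d n * ω n) = gaussianReal 0 (.mk (d n ^ 2) (sq_nonneg _)) := by
    have h1 : P.map (fun ω => ω n) = gaussianReal 0 1 :=
      (measurePreserving_eval_infinitePi _ n).map_eq
    have h2 := gaussianReal_map_const_mul (μ := 0) (v := 1) (d n)
    rw [← h1, Measure.map_map (by fun_prop) (by fun_prop)] at h2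
    simpa [Function.comp_def] using h2
  simp_rw [Finset.prod_apply, hmap, charFun_gaussianReal]
  rw [← Complex.exp_sum]
  congr 1
  push_cast
  rw [neg_mul, neg_div, Finset.sum_mul, Finset.sum_div, ← Finset.sum_neg_distrib]
  refine Finset.sum_congr rfl fun n _ => ?_
  simp

/-- Absolutely summable series in a sequence of independent standard Gaussian variables
converge almost surely. -/
lemma ae_summable_mul_infinitePi_gaussianReal {d : ℕ → ℝ} (hd : Summable fun n => |d n|) :
    ∀ᵐ ω ∂(Measure.infinitePi fun _ : ℕ => gaussianReal 0 1), Summable fun n => d n * ω n := by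
  set P := Measure.infinitePi fun _ : ℕ => gaussianReal 0 1
  have hC (n : ℕ) : ∫⁻ ω, ‖ω n‖ₑ ∂P = ∫⁻ x, ‖x‖ₑ ∂(gaussianReal 0 1) :=
    (measurePreserving_eval_infinitePi (fun _ : ℕ => gaussianReal 0 1) n).lintegral_comp
      (f := fun x : ℝ => ‖x‖ₑ) (by fun_prop)
  have hfin : ∫⁻ x, ‖x‖ₑ ∂(gaussianReal 0 1) ≠ ⊤ := by
    have : Integrable (fun x : ℝ => x) (gaussianReal 0 1) := IsGaussian.integrable_id
    exact this.2.ne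
  have hm (n : ℕ) : AEMeasurable (fun ω : ℕ → ℝ => ‖d n * ω n‖ₑ) P :=
    (measurable_mul_coord (d n) n).enorm.aemeasurable
  -- By Tonelli the expected absolute sum is `∑ |d n|` times the first absolute moment of a standard
  -- Gaussian.
  have hsum : ∫⁻ ω, ∑' n, ‖d n * ω n‖ₑ ∂P ≠ ⊤ := by
    rw [lintegral_tsum (fun n => hm n)]
    simp_rw [enorm_mul]
    have h1 (n : ℕ) : ∫⁻ ω : ℕ → ℝ, ‖d n‖ₑ * ‖ω n‖ₑ ∂P
        = ‖d n‖ₑ * ∫⁻ x, ‖x‖ₑ ∂(gaussianReal 0 1) := by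
      rw [lintegral_const_mul _ (by fun_prop), hC]
    simp_rw [h1]
    rw [ENNReal.tsum_mul_right]
    refine ENNReal.mul_ne_top ?_ hfin
    have : Summable fun n => ‖d n‖₊ := by
      rw [← NNReal.summable_coe]; simpa using hd
    simpa [enorm_eq_nnnorm] using ENNReal.tsum_coe_ne_top_iff_summable.2 this
  filter_upwards [ae_lt_top' (AEMeasurable.tsum hm) hsum] with ω hω
  have : Summable fun n => ‖d n * ω n‖₊ := by
    rw [← ENNReal.tsum_coe_ne_top_iff_summable]
    simpa [enorm_eq_nnnorm] using hω.ne
  refine Summable.of_norm ?_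
  simpa using NNReal.summable_coe.2 this

lemma summable_mul_of_summable_abs {c d : ℕ → ℝ} (hc : Summable fun n => |c n|)
    (hd : Summable fun n => |d n|) : Summable fun n => c n * d n := by
  refine Summable.of_abs ?_
  have h := hc.mul_of_nonneg hd (fun _ => abs_nonneg _) (fun _ => abs_nonneg _)
  simp_rw [abs_mul]
  exact h.comp_injective (i := fun n : ℕ => (n, n)) (fun a b h => (Prod.mk.inj h).1)

/-- The law of an absolutely summable series in independent standard Gaussian variables. -/
lemma map_tsum_mul_infinitePi_gaussianReal {d : ℕ → ℝ} (hd : Summable fun n => |d n|) :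
    (Measure.infinitePi fun _ : ℕ => gaussianReal 0 1).map (fun ω => ∑' n, d n * ω n) =
      gaussianReal 0 (∑' n, d n ^ 2).toNNReal := by
  set P := Measure.infinitePi fun _ : ℕ => gaussianReal 0 1
  have hd2 : Summable fun n => d n ^ 2 := by
    simpa [← sq] using summable_mul_of_summable_abs hd hd
  have hmeas : Measurable fun ω : ℕ → ℝ => ∑' n, d n * ω n := by fun_prop
  refine Measure.ext_of_charFun (funext fun u => ?_)
  have hmN (N : ℕ) : Measurable fun ω : ℕ → ℝ => ∑ n ∈ Finset.range N, d n * ω n :=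
    Finset.measurable_fun_sum _ fun n _ => measurable_mul_coord (d n) n
  have hexp : Continuous fun x : ℝ => Complex.exp (inner ℝ x u * Complex.I) := by fun_prop
  have hlim : Tendsto (fun N => charFun (P.map (fun ω => ∑ n ∈ Finset.range N, d n * ω n)) u)
      atTop (𝓝 (charFun (P.map (fun ω => ∑' n, d n * ω n)) u)) := by
    simp_rw [charFun_apply]
    rw [integral_map hmeas.aemeasurable (by fun_prop)]
    have h1 (N : ℕ) : ∫ x, Complex.exp (inner ℝ x u * Complex.I)
          ∂(P.map (fun ω => ∑ n ∈ Finset.range N, d n * ω n)) =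
        ∫ ω, Complex.exp (inner ℝ (∑ n ∈ Finset.range N, d n * ω n) u * Complex.I) ∂P := by
      rw [integral_map (hmN N).aemeasurable hexp.measurable.aestronglyMeasurable]
    simp_rw [h1]
    refine tendsto_integral_of_dominated_convergence (fun _ => 1)
      (fun N => (hexp.measurable.comp (hmN N)).aestronglyMeasurable)
      (by simp) (fun N => ae_of_all _ fun ω => ?_) ?_
    · rw [Complex.norm_exp_ofReal_mul_I]
    · filter_upwards [ae_summable_mul_infinitePi_gaussianReal hd] with ω hω
      exact (hexp.tendsto _).comp hω.hasSum.tendsto_sum_nat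
  refine tendsto_nhds_unique hlim ?_
  simp_rw [P, charFun_map_finsetSum_mul_infinitePi_gaussianReal, charFun_gaussianReal,
    Real.coe_toNNReal _ (tsum_nonneg fun n => sq_nonneg (d n))]
  have hc : Continuous fun x : ℝ => Complex.exp (-(x : ℂ) * u ^ 2 / 2) := by fun_prop
  convert (hc.tendsto _).comp hd2.hasSum.tendsto_sum_nat using 2
  · rfl
  · congr 1
    rw [Complex.ofReal_zero]
    ring

/-- Series with deterministic coefficients in independent standard Gaussian variables form a
centered Gaussian process. -/
lemma isCenteredGaussianWithCov_tsum {S : Type*} (c : S → ℕ → ℝ)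
    (hc : ∀ s, Summable fun n => |c s n|) :
    IsCenteredGaussianWithCov (fun s (ω : ℕ → ℝ) => ∑' n, c s n * ω n)
      (Measure.infinitePi fun _ : ℕ => gaussianReal 0 1) (fun s t => ∑' n, c s n * c t n) := by
  set P := Measure.infinitePi fun _ : ℕ => gaussianReal 0 1
  have hmeas (d : ℕ → ℝ) : Measurable fun ω : ℕ → ℝ => ∑' n, d n * ω n := by fun_prop
  have hG : IsGaussianProcess (fun s (ω : ℕ → ℝ) => ∑' n, c s n * ω n) P := by
    refine ⟨fun F => ⟨isGaussian_of_map_eq_gaussianReal fun L => ?_⟩⟩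
    obtain ⟨l, hL⟩ := exists_strongDual_pi_eq_sum L
    -- A linear functional of finitely many such series is again such a series, so its law is
    -- already known.
    have hd : Summable fun n => |∑ i : F, l i * c i n| := by
      refine Summable.of_nonneg_of_le (fun _ => abs_nonneg _)
        (fun n => Finset.abs_sum_le_sum_abs _ _) (summable_sum fun i _ => ?_)
      simp_rw [abs_mul]
      exact (hc i).mul_left _
    refine ⟨_, _, Eq.trans ?_ (map_tsum_mul_infinitePi_gaussianReal hd)⟩
    rw [Measure.map_map (by fun_prop) (by
      exact measurable_pi_iff.2 fun i => hmeas (c i))]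
    refine Measure.map_congr ?_
    have hae : ∀ᵐ ω ∂P, ∀ i : F, Summable fun n => c i n * ω n :=
      ae_all_iff.2 fun i => ae_summable_mul_infinitePi_gaussianReal (hc i)
    filter_upwards [hae] with ω hω
    simp only [Function.comp_apply, hL, Finset.restrict, Finset.sum_mul]
    rw [Summable.tsum_finsetSum (fun i _ => by simpa [mul_assoc] using (hω i).mul_left _)]
    refine Finset.sum_congr rfl fun i _ => ?_
    rw [← tsum_mul_left]
    simp [mul_assoc]
  have hint {d : ℕ → ℝ} (hd : Summable fun n => |d n|) :
      MemLp (fun ω : ℕ → ℝ => ∑' n, d n * ω n) 2 P ∧ ∫ ω, ∑' n, d n * ω n ∂P = 0 ∧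
      ∫ ω, (∑' n, d n * ω n) ^ 2 ∂P = ∑' n, d n ^ 2 := by
    have hlaw := map_tsum_mul_infinitePi_gaussianReal hd
    have hg : HasGaussianLaw (fun ω : ℕ → ℝ => ∑' n, d n * ω n) P := ⟨by
      rw [hlaw]; infer_instance⟩
    have hm : ∫ ω, ∑' n, d n * ω n ∂P = 0 := by
      have := integral_map (hmeas d).aemeasurable (μ := P) (f := fun x : ℝ => x) (by fun_prop)
      rw [hlaw] at this
      simpa using this.symm
    refine ⟨hg.memLp_two, hm, ?_⟩
    have hv : Var[fun ω : ℕ → ℝ => ∑' n, d n * ω n; P] = ∑' n, d n ^ 2 := by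
      have := variance_map (μ := P) (X := fun x : ℝ => x) (by fun_prop) (hmeas d).aemeasurable
      rw [hlaw] at this
      rw [Function.comp_def] at this
      rw [← this]
      simp [tsum_nonneg fun n => sq_nonneg (d n)]
    rw [variance_eq_sub hg.memLp_two, hm] at hv
    simpa using hv
  refine ⟨hG, fun s => (hint (hc s)).2.1, fun s t => ?_⟩
  have hs := (hint (hc s)).2.2
  have ht := (hint (hc t)).2.2
  -- Polarization: the covariance is read off from the second moments at `c s`, `c t` and `c s + c
  -- t`.
  have hcst : Summable fun n => |c s n + c t n| :=
    Summable.of_nonneg_of_le (fun _ => abs_nonneg _) (fun n => abs_add_le _ _) ((hc s).add (hc t))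
  have hst := (hint hcst).2.2
  have hmul (p q : S) : Summable fun n => c p n * c q n :=
    summable_mul_of_summable_abs (hc p) (hc q)
  have hms := (hint (hc s)).1
  have hmt := (hint (hc t)).1
  have e1 : ∫ ω, (∑' n, (c s n + c t n) * ω n) ^ 2 ∂P =
      ∫ ω, ((∑' n, c s n * ω n) ^ 2 + (∑' n, c t n * ω n) ^ 2) +
        2 * ((∑' n, c s n * ω n) * (∑' n, c t n * ω n)) ∂P := by
    refine integral_congr_ae ?_
    filter_upwards [ae_summable_mul_infinitePi_gaussianReal (hc s),
      ae_summable_mul_infinitePi_gaussianReal (hc t)] with ω h1 h2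
    simp_rw [add_mul]
    rw [h1.tsum_add h2]
    ring
  have hi1 : Integrable (fun ω : ℕ → ℝ => (∑' n, c s n * ω n) ^ 2 + (∑' n, c t n * ω n) ^ 2) P :=
    hms.integrable_sq.add hmt.integrable_sq
  have hi2 : Integrable (fun ω : ℕ → ℝ =>
      2 * ((∑' n, c s n * ω n) * (∑' n, c t n * ω n))) P :=
    (hms.integrable_mul hmt).const_mul 2
  rw [e1, integral_add hi1 hi2, integral_add hms.integrable_sq hmt.integrable_sq,
    integral_const_mul, hs, ht] at hst
  have e2 : ∑' n, (c s n + c t n) ^ 2 =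
      (∑' n, c s n ^ 2 + ∑' n, c t n ^ 2) + 2 * ∑' n, c s n * c t n := by
    have h1 := hmul s s
    have h2 := hmul t t
    simp_rw [← sq] at h1 h2
    rw [← tsum_mul_left, ← h1.tsum_add h2, ← (h1.add h2).tsum_add ((hmul s t).mul_left 2)]
    exact tsum_congr fun n => by ring
  rw [e2] at hst
  linarith

lemma abs_tanh_lt_one (t : ℝ) : |Real.tanh t| < 1 := by
  rw [abs_lt]; exact ⟨Real.neg_one_lt_tanh t, Real.tanh_lt_one t⟩

/-- A centered Gaussian process on the real line with covariance `1 / cosh (t - s)`. -/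
lemma exists_isCenteredGaussianWithCov_sechCov :
    ∃ (P : Measure (ℕ → ℝ)) (X : ℝ → (ℕ → ℝ) → ℝ), IsCenteredGaussianWithCov X P sechCov := by
  -- The coefficients come from the geometric expansion of `1 / (cosh s * cosh t * (1 - tanh s *
  -- tanh t)) = 1 / cosh (t - s)`.
  have hs (t : ℝ) : Summable fun n : ℕ => |(Real.cosh t)⁻¹ * Real.tanh t ^ n| := by
    simp_rw [abs_mul, abs_pow]
    exact (summable_geometric_of_lt_one (abs_nonneg _) (abs_tanh_lt_one t)).mul_left _
  have h := isCenteredGaussianWithCov_tsum _ hs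
  refine ⟨_, _, h.1, h.2.1, fun s t => (h.2.2 s t).trans ?_⟩
  have hlt : |Real.tanh s * Real.tanh t| < 1 := by
    rw [abs_mul]
    exact mul_lt_one_of_nonneg_of_lt_one_left (abs_nonneg _) (abs_tanh_lt_one s)
      (abs_tanh_lt_one t).le
  have e (n : ℕ) : (Real.cosh s)⁻¹ * Real.tanh s ^ n * ((Real.cosh t)⁻¹ * Real.tanh t ^ n) =
      (Real.cosh s)⁻¹ * (Real.cosh t)⁻¹ * (Real.tanh s * Real.tanh t) ^ n := by
    rw [mul_pow]; ring
  simp_rw [e]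
  rw [tsum_mul_left, tsum_geometric_of_abs_lt_one hlt, sechCov, Real.cosh_sub,
    Real.tanh_eq_sinh_div_cosh, Real.tanh_eq_sinh_div_cosh, one_div, ← mul_inv, ← mul_inv]
  congr 1
  field_simp [(Real.cosh_pos s).ne', (Real.cosh_pos t).ne']

/-! ### Centered Gaussian processes and their covariances -/

/-- Mean and variance of a linear combination of the coordinates of a centered process. -/
lemma IsCenteredGaussianWithCov.integral_sum_and_variance_sum {S Ω : Type*} [MeasurableSpace Ω]
    {U : S → Ω → ℝ} {Q : Measure Ω} {K : S → S → ℝ} (hU : IsCenteredGaussianWithCov U Q K)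
    (F : Finset S) (l : F → ℝ) :
    ∫ ω, ∑ i, l i * U i ω ∂Q = 0 ∧ Var[fun ω => ∑ i, l i * U i ω; Q] =
        ∑ i : F, ∑ j : F, l i * (l j * K i j) := by
  have := hU.1.isProbabilityMeasure
  have hmem (s : S) : MemLp (U s) 2 Q := (hU.1.hasGaussianLaw_eval s).memLp_two
  constructor
  · rw [integral_finsetSum _ fun (i : F) _ => ((hmem i).integrable (by norm_num)).const_mul _]
    simp [integral_const_mul, hU.2.1]
  · rw [variance_fun_sum fun i : F => (hmem i).const_mul _]
    refine Finset.sum_congr rfl fun i _ => Finset.sum_congr rfl fun j _ => ?_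
    rw [covariance_const_mul_left, covariance_const_mul_right,
      covariance_eq_sub (hmem i) (hmem j), hU.2.1, hU.2.1]
    simp [hU.2.2]

/-- Two centered Gaussian processes with the same covariance have the same finite-dimensional
distributions. -/
lemma IsCenteredGaussianWithCov.fddEq {S Ω Ω' : Type*} [MeasurableSpace Ω] [MeasurableSpace Ω']
    {V : S → Ω → ℝ} {μ : Measure Ω} {W : S → Ω' → ℝ} {P : Measure Ω'} {K : S → S → ℝ}
    (hV : IsCenteredGaussianWithCov V μ K) (hW : IsCenteredGaussianWithCov W P K) :
    FDDEq V μ W P := by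
  intro F
  have hVF := hV.1.hasGaussianLaw F
  have hWF := hW.1.hasGaussianLaw F
  have := hVF.isProbabilityMeasure
  have := hWF.isProbabilityMeasure
  refine ⟨hVF.aemeasurable, hWF.aemeasurable, ?_⟩
  refine Measure.ext_of_charFunDual (funext fun L => ?_)
  rw [hVF.charFunDual_map_eq_fun, hWF.charFunDual_map_eq_fun]
  obtain ⟨l, hL⟩ := exists_strongDual_pi_eq_sum L
  simp only [hL, Finset.restrict]
  rw [(hV.integral_sum_and_variance_sum F l).1, (hV.integral_sum_and_variance_sum F l).2,
    (hW.integral_sum_and_variance_sum F l).1, (hW.integral_sum_and_variance_sum F l).2]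

/-- Rescaling and reindexing a centered Gaussian process. -/
lemma IsCenteredGaussianWithCov.mul_comp {S S' Ω : Type*} [MeasurableSpace Ω]
    {V : S → Ω → ℝ} {P : Measure Ω} {K : S → S → ℝ} (hV : IsCenteredGaussianWithCov V P K)
    (a : S' → ℝ) (ψ : S' → S) :
    IsCenteredGaussianWithCov (fun t ω => a t * V (ψ t) ω) P
      (fun s t => a s * a t * K (ψ s) (ψ t)) := by
  refine ⟨?_, fun s => ?_, fun s t => ?_⟩
  · simpa using (hV.1.comp_right ψ).smul a
  · simp [integral_const_mul, hV.2.1]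
  · simp only
    rw [← hV.2.2, ← integral_const_mul]
    exact integral_congr_ae (ae_of_all _ fun ω => by ring)

/-! ### Conditioning on a vanishing coordinate -/

/-- The kernel which translates a fixed law along a line. -/
lemma exists_kernel_translate {ι : Type*} [Finite ι] (ν : Measure (ι → ℝ))
    [IsProbabilityMeasure ν] (c : ι → ℝ) :
    ∃ η : Kernel ℝ (ι → ℝ), IsMarkovKernel η ∧ (∀ v, η v = ν.map fun w => w + v • c) ∧
      ∀ (ρ : Measure ℝ) [IsProbabilityMeasure ρ],
        ρ ⊗ₘ η = (ρ.prod ν).map fun p => (p.1, p.2 + p.1 • c) := by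
  have hf : Measurable fun p : ℝ × (ι → ℝ) => p.2 + p.1 • c := by fun_prop
  let η : Kernel ℝ (ι → ℝ) := (Kernel.id ×ₖ Kernel.const ℝ ν).map fun p => p.2 + p.1 • c
  have hη (v : ℝ) : η v = ν.map fun w => w + v • c := by
    simp only [η]
    rw [Kernel.map_apply _ hf, Kernel.prod_apply, Kernel.id_apply, Kernel.const_apply,
      Measure.dirac_prod, Measure.map_map hf (by fun_prop)]
    rfl
  have hM : IsMarkovKernel η := Kernel.IsMarkovKernel.map _ hf
  refine ⟨η, hM, hη, fun ρ _ => ?_⟩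
  ext s hs
  have hg : Measurable fun p : ℝ × (ι → ℝ) => (p.1, p.2 + p.1 • c) := by fun_prop
  rw [Measure.compProd_apply hs, Measure.map_apply hg hs, Measure.prod_apply (hg hs)]
  refine lintegral_congr fun v => ?_
  rw [hη, Measure.map_apply (by fun_prop) (measurable_prodMk_left hs)]
  rfl

/-- The conditional law of a centered Gaussian process given that one nondegenerate coordinate
vanishes is the law of the residual of the regression on that coordinate. -/
lemma IsCondLawAt.map_restrict_eq {T Ω : Type*} [MeasurableSpace Ω] {μ : Measure Ω}
    {Z : T → Ω → ℝ} (hZmeas : ∀ t, Measurable (Z t)) {K : T → T → ℝ}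
    (hZ : IsCenteredGaussianWithCov Z μ K) {s₀ : T} (hs₀ : K s₀ s₀ ≠ 0) {ν : Measure (T → ℝ)}
    (h : IsCondLawAt μ Z (Z s₀) 0 ν) (F : Finset T) :
    ν.map F.restrict =
      μ.map fun ω => F.restrict fun t => Z t ω - K t s₀ / K s₀ s₀ * Z s₀ ω := by
  obtain ⟨κ, hκ, hdis, hcont, rfl⟩ := h
  have hP : IsProbabilityMeasure μ := hZ.1.isProbabilityMeasure
  have hmem (s : T) : MemLp (Z s) 2 μ := (hZ.1.hasGaussianLaw_eval s).memLp_two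
  have hcov (s t : T) : cov[Z s, Z t; μ] = K s t := by
    rw [covariance_eq_sub (hmem s) (hmem t), hZ.2.1, hZ.2.1, ← hZ.2.2]
    simp
  have hF : Measurable (F.restrict : (T → ℝ) → F → ℝ) := Finset.measurable_restrict F
  set c : T → ℝ := fun t => K t s₀ / K s₀ s₀ with hc
  set R : Ω → F → ℝ := fun ω => F.restrict fun t => Z t ω - c t * Z s₀ ω with hR
  have hRmeas : Measurable R := measurable_pi_iff.2 fun i => by
    simp only [hR, Finset.restrict]
    exact (hZmeas i).sub ((hZmeas s₀).const_mul _)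
  -- The regression coefficient makes the residual uncorrelated with `Z s₀`; joint Gaussianity
  -- upgrades this to independence.
  have hind : IndepFun (Z s₀) R μ := by
    have hG : IsGaussianProcess (Sum.elim (fun _ : Unit => Z s₀)
        (fun (i : F) ω => Z i ω - c i * Z s₀ ω)) μ := by
      classical
      refine IsGaussianProcess.of_isGaussianProcess hZ.1 ?_
      rintro (_ | i)
      · exact ⟨{s₀}, .proj ⟨s₀, by simp⟩, fun ω => by simp⟩
      · exact ⟨{s₀, (i : T)}, .proj ⟨i, by simp⟩ - c i • .proj ⟨s₀, by simp⟩, fun ω => by simp⟩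
    have := hG.indepFun_of_covariance_eq_zero (fun _ => (hZmeas s₀).aemeasurable)
      (fun i => ((hZmeas i).sub ((hZmeas s₀).const_mul _)).aemeasurable) (fun _ i => by
        rw [covariance_fun_sub_right (hmem _) (hmem _) ((hmem _).const_mul _),
          covariance_const_mul_right, hcov, hcov, hc]
        have : K s₀ i = K i s₀ := by rw [← hcov, covariance_comm, hcov]
        simp only [this]
        field_simp
        simp)
    exact this.comp (φ := fun f : Unit → ℝ => f ()) (ψ := id) (measurable_pi_apply ()) measurable_id
  have hνP : IsProbabilityMeasure (μ.map R) := Measure.isProbabilityMeasure_map hRmeas.aemeasurable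
  have hρP : IsProbabilityMeasure (μ.map (Z s₀)) :=
    Measure.isProbabilityMeasure_map (hZmeas s₀).aemeasurable
  obtain ⟨η, hη, hηv, hηρ⟩ := exists_kernel_translate (μ.map R) (F.restrict c)
  have hκF : IsMarkovKernel (κ.map F.restrict) := Kernel.IsMarkovKernel.map _ hF
  have hZall : Measurable fun ω => (Z s₀ ω, fun t => Z t ω) :=
    (hZmeas s₀).prodMk (measurable_pi_iff.2 hZmeas)
  -- Both kernels disintegrate the joint law of `Z s₀` and the coordinates in `F`, since these equal
  -- `R + Z s₀ • c`.
  have heq : (μ.map (Z s₀)) ⊗ₘ (κ.map F.restrict) = (μ.map (Z s₀)) ⊗ₘ η := by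
    rw [Measure.compProd_map hF, ← hdis, hηρ, ← (indepFun_iff_map_prod_eq_prod_map_map
      (hZmeas s₀).aemeasurable hRmeas.aemeasurable).1 hind,
      Measure.map_map (by fun_prop) hZall, Measure.map_map (by fun_prop)
      ((hZmeas s₀).prodMk hRmeas)]
    congr 1
    funext ω
    simp only [Function.comp_apply, Prod.map_apply, id, Prod.mk.injEq, true_and]
    funext i
    simp only [hR, Finset.restrict, Pi.add_apply, Pi.smul_apply, smul_eq_mul]
    ring
  have hae := Kernel.ae_eq_of_compProd_eq heq
  have hgauss : μ.map (Z s₀) = gaussianReal 0 (K s₀ s₀).toNNReal := by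
    rw [(hZ.1.hasGaussianLaw_eval s₀).map_eq_gaussianReal, hZ.2.1, ← hcov,
      covariance_self (hZmeas s₀).aemeasurable]
  have hpos : (K s₀ s₀).toNNReal ≠ 0 := by
    have : 0 ≤ K s₀ s₀ := by
      rw [← hZ.2.2]; exact integral_nonneg fun ω => mul_self_nonneg _
    simpa using lt_of_le_of_ne this hs₀.symm
  rw [hgauss] at hae
  -- Lebesgue measure is absolutely continuous with respect to a nondegenerate Gaussian law, so the
  -- kernels agree on a dense set. Weak continuity of both at `0` then carries the equality to the
  -- null point `0`.
  have hvol := (gaussianReal_absolutelyContinuous' 0 hpos).ae_le hae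
  have hfreq : ∃ᶠ v in 𝓝 (0 : ℝ), κ.map F.restrict v = η v :=
    mem_closure_iff_frequently.1 (Measure.dense_of_ae hvol 0)
  have hη0 : η 0 = μ.map R := by rw [hηv]; simp
  rw [← hη0, ← Kernel.map_apply _ hF]
  refine ext_of_forall_integral_eq_of_IsFiniteMeasure fun g => ?_
  refine tendsto_nhds_unique_of_frequently_eq (f := fun v => ∫ x, g x ∂(κ.map F.restrict v))
    (g := fun v => ∫ x, g x ∂(η v)) ?_ ?_ (hfreq.mono fun v hv => by simp only [hv])
  · have : ∀ v, ∫ x, g x ∂(κ.map F.restrict v) = ∫ x, g (F.restrict x) ∂(κ v) := fun v => by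
      rw [Kernel.map_apply _ hF, integral_map hF.aemeasurable
        g.continuous.measurable.aestronglyMeasurable]
    simp_rw [this]
    exact hcont F g
  · have : ∀ v, ∫ x, g x ∂(η v) = ∫ w, g (w + v • F.restrict c) ∂(μ.map R) := fun v => by
      rw [hηv, integral_map (by fun_prop) g.continuous.measurable.aestronglyMeasurable]
    simp_rw [this]
    have hc' : Continuous fun v : ℝ => ∫ w, g (w + v • F.restrict c) ∂(μ.map R) := by
      refine continuous_of_dominated (bound := fun _ => ‖g‖) (fun v => ?_)
        (fun v => ae_of_all _ fun w => g.norm_coe_le_norm _) (integrable_const _)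
        (ae_of_all _ fun w => by fun_prop)
      exact (g.continuous.comp (by fun_prop)).measurable.aestronglyMeasurable
    exact hc'.tendsto 0

/-- The covariance identity forced by conditioning at a nondegenerate point. -/
lemma IsCondLawAt.covariance_eq {T Ω : Type*} [MeasurableSpace Ω] {μ : Measure Ω}
    {Z : T → Ω → ℝ} (hZmeas : ∀ t, Measurable (Z t)) {K : T → T → ℝ}
    (hZ : IsCenteredGaussianWithCov Z μ K) {s₀ : T} (hs₀ : K s₀ s₀ ≠ 0) {φ : T → ℝ}
    (h : IsCondLawAt μ Z (Z s₀) 0 (μ.map fun ω t => φ t * Z t ω)) (s t : T) :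
    K s t * (1 - φ s * φ t) = K s s₀ * K t s₀ / K s₀ s₀ := by
  classical
  have hF := h.map_restrict_eq hZmeas hZ hs₀ {s, t}
  have hP : IsProbabilityMeasure μ := hZ.1.isProbabilityMeasure
  have hmem (s : T) : MemLp (Z s) 2 μ := (hZ.1.hasGaussianLaw_eval s).memLp_two
  have hm1 : Measurable fun ω t => φ t * Z t ω :=
    measurable_pi_iff.2 fun t => (hZmeas t).const_mul _
  rw [Measure.map_map (Finset.measurable_restrict _) hm1] at hF
  have hm2 : Measurable fun ω => ({s, t} : Finset T).restrict
      fun t => Z t ω - K t s₀ / K s₀ s₀ * Z s₀ ω :=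
    measurable_pi_iff.2 fun i => (hZmeas i).sub ((hZmeas s₀).const_mul _)
  have hs : s ∈ ({s, t} : Finset T) := by simp
  have ht : t ∈ ({s, t} : Finset T) := by simp
  -- Only the mixed second moment of the two laws is compared.
  have hint := congrArg (fun ρ => ∫ x, x ⟨s, hs⟩ * x ⟨t, ht⟩ ∂ρ) hF
  rw [integral_map ((Finset.measurable_restrict _).comp hm1).aemeasurable
      (Measurable.aestronglyMeasurable (by fun_prop)),
    integral_map hm2.aemeasurable (Measurable.aestronglyMeasurable (by fun_prop))] at hint
  simp only [Function.comp_apply, Finset.restrict] at hint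
  have hi (p q : T) (a : ℝ) : Integrable (fun ω => a * (Z p ω * Z q ω)) μ :=
    ((hmem p).integrable_mul (hmem q)).const_mul a
  have e1 : ∫ ω, φ s * Z s ω * (φ t * Z t ω) ∂μ = φ s * φ t * K s t := by
    rw [← hZ.2.2, ← integral_const_mul]
    exact integral_congr_ae (ae_of_all _ fun ω => by ring)
  have e2 (a b : ℝ) : ∫ ω, (Z s ω - a * Z s₀ ω) * (Z t ω - b * Z s₀ ω) ∂μ =
      K s t - b * K s s₀ - a * K t s₀ + a * b * K s₀ s₀ := by
    have : ∀ ω, (Z s ω - a * Z s₀ ω) * (Z t ω - b * Z s₀ ω) =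
        1 * (Z s ω * Z t ω) - b * (Z s ω * Z s₀ ω) - a * (Z t ω * Z s₀ ω) +
          a * b * (Z s₀ ω * Z s₀ ω) := fun ω => by ring
    simp_rw [this]
    have i1 : Integrable (fun ω => 1 * (Z s ω * Z t ω) - b * (Z s ω * Z s₀ ω)) μ :=
      (hi s t 1).sub (hi s s₀ b)
    have i2 : Integrable (fun ω => 1 * (Z s ω * Z t ω) - b * (Z s ω * Z s₀ ω) -
        a * (Z t ω * Z s₀ ω)) μ := i1.sub (hi t s₀ a)
    rw [integral_add i2 (hi _ _ _), integral_sub i1 (hi _ _ _), integral_sub (hi _ _ _) (hi _ _ _)]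
    simp only [integral_const_mul, hZ.2.2]
    ring
  rw [e1, e2] at hint
  field_simp at hint ⊢
  linarith

/-! ### From the regression identity to `1 / cosh` blocks -/

/-- A kernel of the form `K s t (1 - φ s φ t) = K s s₀ K t s₀ / K s₀ s₀` is, on the set of points
correlated with `s₀`, a rescaling of `1 / cosh`. -/
lemma exists_sechCov_of_regression_identity {T : Type*} {K : T → T → ℝ} {s₀ : T} {φ : T → ℝ}
    (hnonneg : ∀ t, 0 ≤ K t t) (hs₀ : K s₀ s₀ ≠ 0)
    (h : ∀ s t, K s t * (1 - φ s * φ t) = K s s₀ * K t s₀ / K s₀ s₀) :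
    ∃ a ψ : T → ℝ, (∀ t, K t s₀ ≠ 0 → a t ≠ 0) ∧
      ∀ s t, K s s₀ ≠ 0 → K t s₀ ≠ 0 → K s t = a s * a t * sechCov (ψ s) (ψ t) := by
  have hpos : 0 < K s₀ s₀ := lt_of_le_of_ne (hnonneg s₀) hs₀.symm
  refine ⟨fun t => K t s₀ * Real.cosh (Real.artanh (φ t)) / √(K s₀ s₀),
    fun t => Real.artanh (φ t), fun t ht => ?_, fun s t hs ht => ?_⟩
  · have := (Real.cosh_pos (Real.artanh (φ t))).ne'
    have := (Real.sqrt_pos.2 hpos).ne'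
    positivity
  -- The identity on the diagonal has a positive right side, so `1 - φ t ^ 2 > 0`. Off this set
  -- `artanh` may take junk values, but the conclusion says nothing there.
  have hmem (t : T) (ht : K t s₀ ≠ 0) : φ t ∈ Set.Ioo (-1 : ℝ) 1 := by
    have h1 : 0 < K t t * (1 - φ t * φ t) := by rw [h]; exact div_pos (mul_self_pos.2 ht) hpos
    have h2 := (pos_iff_pos_of_mul_pos h1).1 (lt_of_le_of_ne (hnonneg t) fun h0 => by
      rw [← h0] at h1; simp at h1)
    rw [Set.mem_Ioo, ← abs_lt, ← sq_lt_one_iff_abs_lt_one]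
    linarith [sq (φ t)]
  have hψs := Real.tanh_artanh (hmem s hs)
  have hψt := Real.tanh_artanh (hmem t ht)
  have hst := h s t
  simp only [sechCov]
  set p := Real.artanh (φ s)
  set q := Real.artanh (φ t)
  have hp := Real.cosh_pos p
  have hq := Real.cosh_pos q
  have hqp := Real.cosh_pos (q - p)
  have hfac : 1 - φ s * φ t = Real.cosh (q - p) / (Real.cosh p * Real.cosh q) := by
    rw [← hψs, ← hψt, Real.tanh_eq_sinh_div_cosh, Real.tanh_eq_sinh_div_cosh, Real.cosh_sub]
    field_simp
  rw [hfac] at hst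
  have hsq : √(K s₀ s₀) * √(K s₀ s₀) = K s₀ s₀ := Real.mul_self_sqrt hpos.le
  have : K s s₀ * Real.cosh p / √(K s₀ s₀) * (K t s₀ * Real.cosh q / √(K s₀ s₀)) *
      (1 / Real.cosh (q - p)) = K s s₀ * K t s₀ / K s₀ s₀ * (Real.cosh p * Real.cosh q) /
        Real.cosh (q - p) := by
    rw [div_mul_div_comm, hsq]
    field_simp
  rw [this, ← hst]
  field_simp

/-- The covariance of a process satisfying the conditioning property splits into blocks, each of
which is a rescaling of `1 / cosh`. -/
lemma exists_setoid_sechCov {T : Type*} {K : T → T → ℝ} (hsymm : ∀ s t, K s t = K t s)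
    (hnonneg : ∀ t, 0 ≤ K t t) (hdeg : ∀ s t, K s s = 0 → K s t = 0)
    (h : ∀ s₀, K s₀ s₀ ≠ 0 → ∃ φ : T → ℝ,
      ∀ s t, K s t * (1 - φ s * φ t) = K s s₀ * K t s₀ / K s₀ s₀) :
    ∃ (r : Setoid T) (a ψ : T → ℝ), (∀ s t, ¬ r s t → K s t = 0) ∧
      ∀ s t, r s t → K s t = a s * a t * sechCov (ψ s) (ψ t) := by
  have hne (s₀ : T) (hs₀ : K s₀ s₀ ≠ 0) : ∃ a ψ : T → ℝ, (∀ t, K t s₀ ≠ 0 → a t ≠ 0) ∧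
      ∀ s t, K s s₀ ≠ 0 → K t s₀ ≠ 0 → K s t = a s * a t * sechCov (ψ s) (ψ t) :=
    let ⟨_, hφ⟩ := h s₀ hs₀
    exists_sechCov_of_regression_identity hnonneg hs₀ hφ
  let r : Setoid T :=
    -- The equality clause keeps the relation reflexive at degenerate points. Transitivity uses the
    -- middle point as base point.
    { r := fun s t => s = t ∨ K s t ≠ 0
      iseqv := by
        refine ⟨fun _ => .inl rfl, fun {s t} hst => ?_, fun {s t u} hst htu => ?_⟩
        · exact hst.imp Eq.symm fun h => hsymm s t ▸ h
        · rcases hst with rfl | hst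
          · exact htu
          rcases htu with rfl | htu
          · exact .inr hst
          have htt : K t t ≠ 0 := fun h0 => htu (hdeg t u h0)
          obtain ⟨a, ψ, ha, hK⟩ := hne t htt
          rw [hsymm t u] at htu
          right
          rw [hK s u hst htu]
          exact mul_ne_zero (mul_ne_zero (ha s hst) (ha u htu))
            (one_div_ne_zero (Real.cosh_pos _).ne') }
  have hblock (s₀ : T) : ∃ a ψ : T → ℝ,
      ∀ s t, r s s₀ → r t s₀ → K s t = a s * a t * sechCov (ψ s) (ψ t) := by
    by_cases hs₀ : K s₀ s₀ = 0
    · have heq (t : T) (ht : r t s₀) : t = s₀ :=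
        ht.resolve_right fun hk => hk (hsymm t s₀ ▸ hdeg s₀ t hs₀)
      exact ⟨0, 0, fun s t hs ht => by simp [heq s hs, heq t ht, hs₀]⟩
    · obtain ⟨a, ψ, -, hK⟩ := hne s₀ hs₀
      have hr (t : T) (ht : r t s₀) : K t s₀ ≠ 0 := by
        rcases ht with rfl | ht
        exacts [hs₀, ht]
      exact ⟨a, ψ, fun s t hs ht => hK s t (hr s hs) (hr t ht)⟩
  -- The scale and time change depend on the base point, so one representative is fixed per class.
  choose a ψ hK using hblock
  have hout (t : T) : r t (Quotient.mk r t).out := r.symm (Quotient.mk_out t)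
  refine ⟨r, fun t => a (Quotient.mk r t).out t, fun t => ψ (Quotient.mk r t).out t,
    fun s t hst => by_contra fun h0 => hst (.inr h0), fun s t hst => ?_⟩
  have hq : Quotient.mk r s = Quotient.mk r t := Quotient.sound hst
  simp only [hq]
  exact hK _ s t (hq ▸ hout s) (hout t)

/-! ### Assembling the decomposition -/

theorem mainTheorem4 {T : Type u} {Ω : Type v} [MeasurableSpace Ω] (μ : Measure Ω)
    (Z : T → Ω → ℝ) (hZmeas : ∀ t, Measurable (Z t)) (hZ : IsGaussianProcess Z μ)
    (hZmean : ∀ t, ∫ ω, Z t ω ∂μ = 0)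
    (hcond : ∀ s₀ : T, ∃ φ : T → ℝ,
      IsCondLawAt μ Z (Z s₀) 0 (μ.map (fun ω => fun t => φ t * Z t ω))) :
    ∃ (Ω₁ : Type) (_ : MeasurableSpace Ω₁) (P₁ : Measure Ω₁) (X : ℝ → Ω₁ → ℝ),
      IsCenteredGaussianWithCov X P₁ sechCov ∧
    ∃ (I : Type u) (part : I → Set T) (a : T → ℝ),
      (∀ α β, α ≠ β → Disjoint (part α) (part β)) ∧
      (⋃ α, part α) = Set.univ ∧
      iIndepFun (fun (α : I) (ω : Ω) (t : part α) => Z t ω) μ ∧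
      ∀ α : I,
        (∃ ψ : part α → ℝ,
          FDDEq (fun t : part α => Z t) μ (fun t ω => a t * X (ψ t) ω) P₁) ∨
        (∃ ψ : part α → FourPoint, ∃ x y : ℝ, AdmissiblePair x y ∧
          ∃ (Ω₂ : Type) (_ : MeasurableSpace Ω₂) (P₂ : Measure Ω₂) (Y : FourPoint → Ω₂ → ℝ),
            IsCenteredGaussianWithCov Y P₂ (quadCov x y) ∧
            FDDEq (fun t : part α => Z t) μ (fun t ω => a t * Y (ψ t) ω) P₂) := by

  let K : T → T → ℝ := fun s t => ∫ ω, Z s ω * Z t ω ∂μ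
  have hZK : IsCenteredGaussianWithCov Z μ K := ⟨hZ, hZmean, fun _ _ => rfl⟩
  have hP : IsProbabilityMeasure μ := hZ.isProbabilityMeasure
  have hmem (s : T) : MemLp (Z s) 2 μ := (hZ.hasGaussianLaw_eval s).memLp_two
  -- Zero variance means `Z s = 0` almost surely.
  have hdeg (s t : T) (h0 : K s s = 0) : K s t = 0 := by
    have hz := (integral_eq_zero_iff_of_nonneg (fun ω => mul_self_nonneg (Z s ω))
      ((hmem s).integrable_mul (hmem s))).1 h0
    refine integral_eq_zero_of_ae ?_
    filter_upwards [hz] with ω hω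
    simp [mul_self_eq_zero.1 hω]
  obtain ⟨r, a, ψ, hr₀, hr⟩ := exists_setoid_sechCov (K := K)
    (fun s t => by simp only [K, mul_comm]) (fun t => integral_nonneg fun ω => mul_self_nonneg _)
    hdeg (fun s₀ hs₀ => (hcond s₀).imp fun φ hφ => hφ.covariance_eq hZmeas hZK hs₀)
  obtain ⟨P₁, X, hX⟩ := exists_isCenteredGaussianWithCov_sechCov
  -- Every block, including a degenerate singleton (with `a = 0`), falls under the `1 / cosh`
  -- alternative.
  refine ⟨ℕ → ℝ, inferInstance, P₁, X, hX, Quotient r, fun α => {t | Quotient.mk r t = α}, a,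
    fun α β hαβ => ?_, ?_, ?_, fun α => .inl ⟨fun t => ψ t, ?_⟩⟩
  · exact Set.disjoint_left.2 fun t h1 h2 => hαβ (h1.symm.trans h2)
  · exact Set.eq_univ_of_forall fun t => Set.mem_iUnion.2 ⟨Quotient.mk r t, rfl⟩
  · refine IsGaussianProcess.iIndepFun_of_covariance_eq_zero
      (X := fun (α : Quotient r) (t : {t | Quotient.mk r t = α}) => Z t)
      (hZ.comp_right fun p : (α : Quotient r) × {t | Quotient.mk r t = α} => (p.2 : T))
      (fun _ t => (hZmeas t).aemeasurable) fun α β hαβ s t => ?_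
    rw [covariance_eq_sub (hmem s) (hmem t), hZmean, hZmean]
    have : K s t = 0 := hr₀ s t fun hst =>
      hαβ (s.2.symm.trans ((Quotient.sound hst).trans t.2))
    simpa [K] using this
  · have hV : IsCenteredGaussianWithCov
        (fun t : {t | Quotient.mk r t = α} => Z t) μ
        (fun s t => a s * a t * sechCov (ψ s) (ψ t)) :=
      ⟨hZ.restrict _, fun s => hZmean s, fun s t =>
        hr s t (Quotient.exact (s.2.trans t.2.symm))⟩
    exact hV.fddEq (hX.mul_comp (fun t : {t | Quotient.mk r t = α} => a t) fun t => ψ t)
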